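/- **Setting.** Let $d\ge 1$, let $\Omega$ be a Polish space with a Borel probability measure $\mathbb P$ (expectation $\mathbb E$), and let $\overline{\mathcal B(\Omega)}$ be the $\mathbb P$-completion of its Borel $\sigma$-algebra. Let $(T_{\mathbf x})_{\mathbf x\in\mathbb R^d}$ be a group of transformations of $\Omega$ such that $T_{\mathbf x}(A)\in\overline{\mathcal B(\Omega)}$ and $\mathbb P(T_{\mathbf x}(A))=\mathbb P(A)$ for all $\mathbf x\in\mathbb R^d$ and $A\in\overline{\mathcal B(\Omega)}$. Let $\mathbf u:\Omega\to\mathbb R^d$ be $\overline{\mathcal B(\Omega)}$-measurable, put $\mathbf v=\mathbb E\mathbf u$, $\tilde{\mathbf u}=\mathbf u-\mathbf v$, and write $\mathbf u(\mathbf x;\omega)=\mathbf u(T_{\mathbf x}\omega)$ and $\tilde{\mathbf u}(\mathbf x;\omega)=\mathbf u(\mathbf x;\omega)-\mathbf v$. Assume: - (A) $|\mathbf v|>\|\tilde{\mathbf u}\|_{L^\infty(\mathbb P)}$; put $\hat{\mathbf v}=\mathbf v/|\mathbf v|$. - (DR) There is $r_0>0$ such that for every $r>0$ the $\sigma$-algebras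 generated by $\{\mathbf u(\mathbf x):|\mathbf x|\le r\}$ and by $\{\mathbf u(\mathbf x):|\mathbf x|\ge r+r_0\}$ are independent. - (R) For every $\omega$ the field $\mathbf u(\cdot;\omega)$ is of class $C^1$; there is a deterministic $U>0$ with $\|\tilde{\mathbf u}(\cdot;\omega)\|_{W^{1,\infty}(\mathbb R^d)}\le U$ for every $\omega$; and for all $N\ge1$ and pairwise distinct $\mathbf x_1,\dots,\mathbf x_N$ the law of $(\mathbf u(\mathbf x_1),\dots,\mathbf u(\mathbf x_N))$ is absolutely continuous with respect to Lebesgue measure on $(\mathbb R^d)^N$. Let $Q_{\mathbf x,\omega}$ be the law on $C([0,\infty);\mathbb R^d)$ of the solution of $d\mathbf x(t)=\mathbf u(\mathbf x(t);\omega)\,dt+d\mathbf w(t)$, $\mathbf x(0)=\mathbf x$, where $\mathbf w$ is a standard $d$-dimensional Brownian motion. For a path $\pi$ and $a\in\mathbb R$ let (with $\min\emptyset=+\infty$) $$U_a(\pi)=\min\{t\ge0:\hat{\mathbf v}\cdot\pi(t)\ge a\},\qquad \tilde U_a(\pi)=\min\{t\ge0:\hat{\mathbf v}\cdot\pi(t)\le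 a\},$$ $$D(\pi)=\min\{t\ge0:\hat{\mathbf v}\cdot\pi(t)\le\hat{\mathbf v}\cdot\pi(0)-1\},$$ and, when $D(\pi)<+\infty$, let $M_*(\pi)=\sup\{\hat{\mathbf v}\cdot(\pi(t)-\pi(0)):0\le t\le D(\pi)\}$. **Lemma 3.1.** There exist deterministic constants $\gamma,\gamma_1,\gamma_2>0$ such that for every $\mathbf x\in\mathbb R^d$ the following hold for $\mathbb P$-almost every $\omega$: $$Q_{\mathbf x,\omega}[D=+\infty]\ge\gamma,$$ $$Q_{\mathbf x,\omega}\big[\tilde U_{\mathbf x\cdot\hat{\mathbf v}-M}<U_{\mathbf x\cdot\hat{\mathbf v}+M}\big]\le e^{-\gamma_1M}\quad\text{for all }M>0,$$ $$\int_{\{D<+\infty\}}M_*\,dQ_{\mathbf x,\omega}\le\gamma_2,$$ where $M_*$ is $Q_{\mathbf x,\omega}$-integrable on $\{D<+\infty\}$. -/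

import Mathlib

open MeasureTheory ProbabilityTheory Set
open scoped ENNReal NNReal

noncomputable section

namespace PassiveTracer

/-- Euclidean space `ℝ^d`. -/
abbrev E (d : ℕ) : Type := EuclideanSpace ℝ (Fin d)

/-! ### The random environment

The group of transformations `T_x` of `Ω`, `x ∈ ℝ^d`, is an additive action of `ℝ^d`, so that
`T_x ω` is written `x +ᵥ ω`. The completion of the Borel `σ`-algebra of `Ω` with respect to `P`
consists of the sets `A` with `NullMeasurableSet A P`. -/

section Environment

variable {d : ℕ} {Ω : Type*} [MeasurableSpace Ω] [AddAction (E d) Ω]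

/-- Spatial homogeneity: each `T_x` maps sets of the completed `σ`-algebra to such sets and
preserves their probability. -/
def SpatiallyHomogeneous (d : ℕ) {Ω : Type*} [MeasurableSpace Ω] [AddAction (E d) Ω]
    (P : Measure Ω) : Prop :=
  ∀ (x : E d) (A : Set Ω), NullMeasurableSet A P →
    NullMeasurableSet ((fun ω => x +ᵥ ω) '' A) P ∧ P ((fun ω => x +ᵥ ω) '' A) = P A

/-- The Eulerian velocity field `u(x; ω) = u(T_x ω)`. -/
def field (u : Ω → E d) (ω : Ω) (x : E d) : E d := u (x +ᵥ ω)

/-- The mean velocity `v = 𝔼 u`. -/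
def meanDrift (u : Ω → E d) (P : Measure Ω) : E d := ∫ ω, u ω ∂P

/-- The direction `v / |v|` of the mean velocity. -/
def driftDir (u : Ω → E d) (P : Measure Ω) : E d := ‖meanDrift u P‖⁻¹ • meanDrift u P

/-- The mean velocity dominates the fluctuations: `|v| > ‖u - v‖_{L^∞(P)}`. -/
def CondA (u : Ω → E d) (P : Measure Ω) : Prop :=
  eLpNorm (fun ω => u ω - meanDrift u P) ∞ P < ‖meanDrift u P‖ₑ

/-- The `σ`-algebra generated by the velocities `u(x)`, `x ∈ S`. -/
abbrev fieldSigma (u : Ω → E d) (S : Set (E d)) : MeasurableSpace Ω :=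
  ⨆ x ∈ S, MeasurableSpace.comap (fun ω => field u ω x) inferInstance

/-- Finite dependence range. -/
def CondDR (u : Ω → E d) (P : Measure Ω) : Prop :=
  ∃ r₀ : ℝ, 0 < r₀ ∧ ∀ r : ℝ, 0 < r →
    Indep (fieldSigma u {x | ‖x‖ ≤ r}) (fieldSigma u {x | r + r₀ ≤ ‖x‖}) P

/-- The `W^{1,∞}(ℝ^d)` norm of a `C^1` vector field (its weak gradient is the classical one). -/
def w1InfNorm (f : E d → E d) : ℝ≥0∞ :=
  max (eLpNorm f ∞ volume) (eLpNorm (fderiv ℝ f) ∞ volume)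

/-- Regularity: the realizations of the field are `C^1`, the fluctuations are bounded in
`W^{1,∞}` by a deterministic constant, and the law of the field at finitely many distinct points
is absolutely continuous with respect to Lebesgue measure. -/
structure CondR (u : Ω → E d) (P : Measure Ω) : Prop where
  contDiff : ∀ ω, ContDiff ℝ 1 (field u ω)
  bounded : ∃ U : ℝ, 0 < U ∧
    ∀ ω, w1InfNorm (fun x => field u ω x - meanDrift u P) ≤ ENNReal.ofReal U
  absolutelyContinuous : ∀ (N : ℕ), 1 ≤ N → ∀ x : Fin N → E d, Function.Injective x →
    P.map (fun ω (i : Fin N) => field u ω (x i)) ≪ (volume : Measure (Fin N → E d))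

end Environment

/-! ### Path space and the law of the diffusion -/

section Diffusion

variable {d : ℕ}

/-- The path space `C([0, ∞); ℝ^d)`. -/
abbrev PathSpace (d : ℕ) : Type := C(ℝ≥0, E d)

/-- The canonical filtration: `pathSigma t` is generated by `π ↦ π(s)`, `s ≤ t`. -/
abbrev pathSigma (t : ℝ≥0) : MeasurableSpace (PathSpace d) :=
  ⨆ s ∈ Set.Iic t, MeasurableSpace.comap (fun π : PathSpace d => π s) inferInstance

/-- The `σ`-algebra on path space is the one generated by the canonical filtration. -/
instance instMeasurableSpacePath : MeasurableSpace (PathSpace d) := ⨆ t : ℝ≥0, pathSigma t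

/-- The process `w(t; π) = π(t) - ∫₀ᵗ b(π(s)) ds`. -/
def noise (b : E d → E d) (t : ℝ≥0) (π : PathSpace d) : E d :=
  π t - ∫ s in (0 : ℝ)..(t : ℝ), b (π s.toNNReal)

/-- `Q` is the law on path space of the solution of `dx(t) = b(x(t)) dt + dw(t)`, `x(0) = x`,
with `w` a standard `d`-dimensional Brownian motion: under `Q` the canonical process starts
at `x`, and `w(t) = π(t) - ∫₀ᵗ b(π(s)) ds` (a continuous process) is a standard Brownian motion
starting at `x` relative to the canonical filtration, i.e. for `s ≤ t` the increment
`w(t) - w(s)` is centered Gaussian with covariance `(t - s) I` and independent of the past up to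
time `s`. -/
structure IsDiffusionLaw (b : E d → E d) (x : E d) (Q : Measure (PathSpace d)) : Prop where
  isProbabilityMeasure : IsProbabilityMeasure Q
  start : ∀ᵐ π ∂Q, π 0 = x
  increment_law : ∀ s t : ℝ≥0, s ≤ t →
    HasLaw (fun π => noise b t π - noise b s π)
      (multivariateGaussian 0 (((t : ℝ) - (s : ℝ)) • (1 : Matrix (Fin d) (Fin d) ℝ))) Q
  increment_indep : ∀ s t : ℝ≥0, s ≤ t →
    Indep (MeasurableSpace.comap (fun π => noise b t π - noise b s π) inferInstance)
      (pathSigma s) Q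

/-! ### Hitting times; `e` stands for the direction of the mean velocity -/

/-- The first time `t ≥ 0` at which `π(t) ∈ S`, with value `∞` if there is none. -/
def hitTime (S : Set (E d)) (π : PathSpace d) : ℝ≥0∞ :=
  ⨅ (t : ℝ≥0) (_ : π t ∈ S), (t : ℝ≥0∞)

/-- `U_a(π) = min {t ≥ 0 : e · π(t) ≥ a}`. -/
def timeAbove (e : E d) (a : ℝ) (π : PathSpace d) : ℝ≥0∞ := hitTime {y | a ≤ inner ℝ e y} π

/-- `Ũ_a(π) = min {t ≥ 0 : e · π(t) ≤ a}`. -/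
def timeBelow (e : E d) (a : ℝ) (π : PathSpace d) : ℝ≥0∞ := hitTime {y | inner ℝ e y ≤ a} π

/-- `D(π) = min {t ≥ 0 : e · π(t) ≤ e · π(0) - 1}`, the time of the first unit backtrack. -/
def backtrackTime (e : E d) (π : PathSpace d) : ℝ≥0∞ := timeBelow e (-1 + inner ℝ e (π 0)) π

/-- `M_*(π) = sup {e · (π(t) - π(0)) : 0 ≤ t ≤ D(π)}`, meaningful when `D(π) < ∞`. -/
def maxExcursion (e : E d) (π : PathSpace d) : ℝ :=
  sSup ((fun t : ℝ≥0 => inner ℝ e (π t - π 0)) '' {t | (t : ℝ≥0∞) ≤ backtrackTime e π})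

end Diffusion

end PassiveTracer

end

open PassiveTracer

/-! Only the component of the path along `e = driftDir u P` matters. If `R < |v|` bounds the
fluctuations almost surely at one point, homogeneity and continuity extend the bound to all of
space, so for almost every `ω` the drift along `e` lies everywhere between `c = |v| - R > 0` and `K
= |v| + R`. The displacement along `e` is then squeezed between `c t + B_t` and `K t + B_t`, where
`B = dirNoise` is a one-dimensional Brownian motion under `Q`.

Everything rests on the maximal inequality `measure_exists_lt` for the martingale `exp (θ B_t - θ² t
/ 2)`. A backtrack by `M` forces `B` below the line `-M - c t`, an event of probability at most `exp
(-c M)`: this gives the first two claims. If the path rises above `y` and later backtracks, either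
`B` crosses the line `y / 2 + K t`, or a time of order `y` passes before the backtrack, against the
drift. Both are exponentially unlikely in `y`, so `maxExcursion` has a bounded integral. -/

namespace PassiveTracer

/-! ### Almost sure bounds on the drift over the whole space -/

section Environment

variable {d : ℕ} {Ω : Type*} [MeasurableSpace Ω] [AddAction (E d) Ω]

/-- Almost sure properties of `ω` hold almost surely at every translate of `ω`. -/
lemma SpatiallyHomogeneous.ae_vadd {P : Measure Ω} (hT : SpatiallyHomogeneous d P)
    {p : Ω → Prop} (hp : ∀ᵐ ω ∂P, p ω) (x : E d) : ∀ᵐ ω ∂P, p (x +ᵥ ω) := by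
  rw [ae_iff] at hp ⊢
  -- The preimage of the bad set under `T_x` is its image under `T_{-x}`.
  have h := (hT (-x) {ω | ¬ p ω} (NullMeasurableSet.of_null hp)).2
  rw [hp] at h
  convert h using 2
  ext ω
  simp only [mem_ofPred_eq, mem_image]
  constructor
  · intro hω
    exact ⟨x +ᵥ ω, hω, by simp⟩
  · rintro ⟨ω', hω', rfl⟩
    simpa using hω'

/-- A bound on the fluctuations of `u` holds almost surely along all continuous realizations. -/
lemma SpatiallyHomogeneous.ae_forall_norm_field_sub_le {P : Measure Ω}
    (hT : SpatiallyHomogeneous d P) {u : Ω → E d} (hc : ∀ ω, Continuous (field u ω))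
    {v : E d} {R : ℝ} (hR : ∀ᵐ ω ∂P, ‖u ω - v‖ ≤ R) :
    ∀ᵐ ω ∂P, ∀ y, ‖field u ω y - v‖ ≤ R := by
  -- Each point `y` brings its own null set, so only countably many points can be handled at once;
  -- continuity supplies the others.
  obtain ⟨s, hs, hd⟩ := TopologicalSpace.exists_countable_dense (E d)
  have h : ∀ᵐ ω ∂P, ∀ y ∈ s, ‖field u ω y - v‖ ≤ R :=
    (ae_ball_iff hs).2 fun y _ => hT.ae_vadd hR y
  filter_upwards [h] with ω hω y
  have hcl : IsClosed {y | ‖field u ω y - v‖ ≤ R} :=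
    isClosed_le (((hc ω).sub continuous_const).norm) continuous_const
  exact closure_minimal (fun y hy => hω y hy) hcl (hd y)

omit [AddAction (E d) Ω] in
/-- If the mean velocity dominates the fluctuations, the fluctuations are almost surely bounded by
some `R < |v|`. -/
lemma CondA.exists_ae_norm_sub_le {P : Measure Ω} {u : Ω → E d} (hA : CondA u P) :
    ∃ R : ℝ, 0 ≤ R ∧ R < ‖meanDrift u P‖ ∧ ∀ᵐ ω ∂P, ‖u ω - meanDrift u P‖ ≤ R := by
  unfold CondA at hA
  refine ⟨(eLpNorm (fun ω => u ω - meanDrift u P) ∞ P).toReal, ENNReal.toReal_nonneg, ?_, ?_⟩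
  · rw [← ofReal_norm] at hA
    exact (ENNReal.lt_ofReal_iff_toReal_lt hA.ne_top).1 hA
  · have h := ae_le_eLpNormEssSup (f := fun ω => u ω - meanDrift u P) (μ := P)
    filter_upwards [h] with ω hω
    rw [← toReal_enorm]
    refine ENNReal.toReal_mono hA.ne_top ?_
    rwa [eLpNorm_exponent_top]

omit [AddAction (E d) Ω] in
lemma inner_driftDir_meanDrift (u : Ω → E d) (P : Measure Ω) :
    inner ℝ (driftDir u P) (meanDrift u P) = ‖meanDrift u P‖ := by
  rw [driftDir, real_inner_smul_left, real_inner_self_eq_norm_sq]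
  by_cases h : ‖meanDrift u P‖ = 0
  · simp [h]
  · field_simp

omit [AddAction (E d) Ω] in
lemma norm_driftDir {u : Ω → E d} {P : Measure Ω} (h : meanDrift u P ≠ 0) :
    ‖driftDir u P‖ = 1 := norm_smul_inv_norm h

end Environment

end PassiveTracer

noncomputable section

namespace PassiveTracer

/-! ### Exponential martingales of the directed noise -/

section Diffusion

variable {d : ℕ}

/-- The characteristic function of the projection at `s` is that of the vector at `s • e`. -/
lemma map_inner_multivariateGaussian (e : E d) (v : ℝ≥0) :
    (multivariateGaussian 0 ((v : ℝ) • (1 : Matrix (Fin d) (Fin d) ℝ))).map (fun x => inner ℝ e x)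
      = gaussianReal 0 (v * ‖e‖₊ ^ 2) := by
  have hS : ((v : ℝ) • (1 : Matrix (Fin d) (Fin d) ℝ)).PosSemidef :=
    Matrix.PosSemidef.one.smul v.2
  have : IsProbabilityMeasure
    ((multivariateGaussian 0 ((v : ℝ) • (1 : Matrix (Fin d) (Fin d) ℝ))).map
      (fun x => inner ℝ e x)) := Measure.isProbabilityMeasure_map (by fun_prop)
  apply Measure.ext_of_charFun
  ext s
  rw [charFun_apply_real, integral_map (by fun_prop) (by fun_prop), charFun_gaussianReal]
  have h := charFun_multivariateGaussian (μ := 0) hS (s • e)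
  rw [charFun_apply] at h
  convert h using 1
  · congr 1
    ext x
    rw [real_inner_smul_right, real_inner_comm]
    push_cast
    rfl
  · congr 1
    simp only [Complex.ofReal_zero, mul_zero, zero_mul, inner_zero_right]
    rw [Matrix.smul_mulVec, Matrix.one_mulVec, dotProduct_smul]
    have : (s • e).ofLp ⬝ᵥ (s • e).ofLp = (s * s) * ‖e‖ ^ 2 := by
      rw [EuclideanSpace.real_norm_sq_eq, dotProduct, Finset.mul_sum]
      refine Finset.sum_congr rfl fun i _ => ?_
      simp; ring
    rw [this]
    push_cast
    simp
    ring

lemma pathSigma_mono {s t : ℝ≥0} (h : s ≤ t) :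
    (pathSigma s : MeasurableSpace (PathSpace d)) ≤ pathSigma t :=
  biSup_mono fun _ hr => le_trans hr h

lemma pathSigma_le (t : ℝ≥0) :
    (pathSigma t : MeasurableSpace (PathSpace d)) ≤ instMeasurableSpacePath :=
  le_iSup (fun t : ℝ≥0 => (pathSigma t : MeasurableSpace (PathSpace d))) t

lemma measurable_eval_pathSigma {s t : ℝ≥0} (h : s ≤ t) :
    Measurable[pathSigma t] (fun π : PathSpace d => π s) := by
  rw [measurable_iff_comap_le]
  exact le_iSup₂_of_le s h le_rfl

lemma measurable_eval_path (t : ℝ≥0) : Measurable (fun π : PathSpace d => π t) :=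
  (measurable_eval_pathSigma le_rfl).mono (pathSigma_le t) le_rfl

lemma measurable_noise {b : E d → E d} (hb : Continuous b) (t : ℝ≥0) :
    Measurable[pathSigma t] (noise b t) := by
  refine (measurable_eval_pathSigma le_rfl).sub ?_
  -- Stopping the path at `t` makes the integrand `pathSigma t`-measurable for every `s`, without
  -- changing it on `(0, t]`.
  have h := measurable_uncurry_of_continuous_of_measurable (m := pathSigma t)
    (u := fun (s : ℝ) (π : PathSpace d) => b (π (min s.toNNReal t)))
    (fun π => by fun_prop)
    (fun s => hb.measurable.comp (measurable_eval_pathSigma (min_le_right _ _)))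
  have h2 := (@StronglyMeasurable.integral_prod_left _ _ _ _ (pathSigma t)
    (volume.restrict (Ioc 0 (t : ℝ))) _ _ _ _ h.stronglyMeasurable).measurable
  convert h2 using 2 with π
  rw [intervalIntegral.integral_of_le t.coe_nonneg]
  refine setIntegral_congr_fun measurableSet_Ioc fun s hs => ?_
  have : s.toNNReal ≤ t := Real.toNNReal_le_iff_le_coe.2 hs.2
  simp [min_eq_left this]

lemma continuous_noise {b : E d → E d} (hb : Continuous b) (π : PathSpace d) :
    Continuous (fun t : ℝ≥0 => noise b t π) := by
  unfold noise
  refine π.continuous.sub ?_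
  have hc : Continuous fun s : ℝ => b (π s.toNNReal) := by fun_prop
  exact (intervalIntegral.continuous_primitive (fun a c => hc.intervalIntegrable a c) 0).comp
    NNReal.continuous_coe

/-- The increment over `[0, t]` of the driving noise, in the direction `e`. -/
def dirNoise (b : E d → E d) (e : E d) (t : ℝ≥0) (π : PathSpace d) : ℝ :=
  inner ℝ e (noise b t π - noise b 0 π)

lemma measurable_dirNoise {b : E d → E d} (hb : Continuous b) (e : E d) (t : ℝ≥0) :
    Measurable[pathSigma t] (dirNoise b e t) :=
  (continuous_const.inner continuous_id).measurable.comp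
    ((measurable_noise hb t).sub ((measurable_noise hb 0).mono (pathSigma_mono zero_le) le_rfl))

lemma continuous_dirNoise {b : E d → E d} (hb : Continuous b) (e : E d) (π : PathSpace d) :
    Continuous (fun t : ℝ≥0 => dirNoise b e t π) :=
  continuous_const.inner ((continuous_noise hb π).sub continuous_const)

lemma dirNoise_zero (b : E d → E d) (e : E d) (π : PathSpace d) : dirNoise b e 0 π = 0 := by
  simp [dirNoise]

lemma dirNoise_sub (b : E d → E d) (e : E d) (s t : ℝ≥0) (π : PathSpace d) :
    dirNoise b e t π - dirNoise b e s π = inner ℝ e (noise b t π - noise b s π) := by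
  simp only [dirNoise, inner_sub_right]
  ring

namespace IsDiffusionLaw

variable {b : E d → E d} {x e : E d} {Q : Measure (PathSpace d)}

lemma map_dirNoise_sub (hQ : IsDiffusionLaw b x Q) (he : ‖e‖ = 1) {s t : ℝ≥0} (hst : s ≤ t) :
    Q.map (fun π => dirNoise b e t π - dirNoise b e s π) = gaussianReal 0 (t - s) := by
  have h := hQ.increment_law s t hst
  simp only [dirNoise_sub]
  have h2 := map_inner_multivariateGaussian e (t - s)
  rw [NNReal.coe_sub hst, ← h.map_eq, AEMeasurable.map_map_of_aemeasurable (by fun_prop)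
    h.aemeasurable] at h2
  have he' : ‖e‖₊ = 1 := NNReal.eq he
  simpa [he', Function.comp_def] using h2

lemma integrable_exp_dirNoise_sub (hQ : IsDiffusionLaw b x Q) (hb : Continuous b) (he : ‖e‖ = 1)
    {s t : ℝ≥0} (hst : s ≤ t) (θ : ℝ) :
    Integrable (fun π => Real.exp (θ * (dirNoise b e t π - dirNoise b e s π))) Q := by
  have h := integrable_exp_mul_gaussianReal (μ := 0) (v := t - s) θ
  rw [← hQ.map_dirNoise_sub he hst] at h
  refine h.comp_measurable ?_
  exact ((measurable_dirNoise hb e t).mono (pathSigma_le t) le_rfl).sub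
    ((measurable_dirNoise hb e s).mono (pathSigma_le s) le_rfl)

lemma integral_exp_dirNoise_sub (hQ : IsDiffusionLaw b x Q) (he : ‖e‖ = 1)
    {s t : ℝ≥0} (hst : s ≤ t) (θ : ℝ) :
    ∫ π, Real.exp (θ * (dirNoise b e t π - dirNoise b e s π)) ∂Q
      = Real.exp (θ ^ 2 * ((t : ℝ) - s) / 2) := by
  have h := mgf_gaussianReal (hQ.map_dirNoise_sub he hst) θ
  rw [NNReal.coe_sub hst] at h
  rw [mgf] at h
  rw [h]
  congr 1
  ring

end IsDiffusionLaw

/-- The exponential `exp (θ B_t - θ² t / 2)` of the directed noise `B`. -/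
def expNoise (b : E d → E d) (e : E d) (θ : ℝ) (t : ℝ≥0) (π : PathSpace d) : ℝ :=
  Real.exp (θ * dirNoise b e t π - θ ^ 2 * t / 2)

lemma measurable_expNoise {b : E d → E d} (hb : Continuous b) (e : E d) (θ : ℝ) (t : ℝ≥0) :
    Measurable[pathSigma t] (expNoise b e θ t) :=
  Real.measurable_exp.comp (((measurable_dirNoise hb e t).const_mul θ).sub_const _)

/-- Splits off a factor known at time `s` from one that depends only on the later increment and has
mean one. -/
lemma expNoise_add (b : E d → E d) (e : E d) (θ : ℝ) (s t : ℝ≥0) :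
    expNoise b e θ t = expNoise b e θ s * fun π =>
      Real.exp (θ * (dirNoise b e t π - dirNoise b e s π)) *
        Real.exp (- (θ ^ 2 * ((t : ℝ) - s) / 2)) := by
  ext π
  simp only [expNoise, Pi.mul_apply, ← Real.exp_add]
  congr 1
  ring

/-- The canonical filtration sampled at the times `t 0 ≤ t 1 ≤ ⋯`. -/
def sampledFiltration (t : ℕ → ℝ≥0) (ht : Monotone t) :
    Filtration ℕ (instMeasurableSpacePath : MeasurableSpace (PathSpace d)) where
  seq n := pathSigma (t n)
  mono' _ _ h := pathSigma_mono (ht h)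
  le' n := pathSigma_le (t n)

namespace IsDiffusionLaw

variable {b : E d → E d} {x e : E d} {Q : Measure (PathSpace d)}

lemma integrable_expNoise (hQ : IsDiffusionLaw b x Q) (hb : Continuous b) (he : ‖e‖ = 1)
    (θ : ℝ) (t : ℝ≥0) : Integrable (expNoise b e θ t) Q := by
  rw [expNoise_add b e θ 0 t]
  have h := (hQ.integrable_exp_dirNoise_sub hb he (s := 0) (t := t) zero_le θ).mul_const
    (Real.exp (- (θ ^ 2 * ((t : ℝ) - (0 : ℝ≥0)) / 2)))
  refine h.congr (Filter.Eventually.of_forall fun π => ?_)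
  simp [expNoise, dirNoise_zero]

lemma integral_expNoise (hQ : IsDiffusionLaw b x Q) (he : ‖e‖ = 1)
    (θ : ℝ) (t : ℝ≥0) : ∫ π, expNoise b e θ t π ∂Q = 1 := by
  have h := hQ.integral_exp_dirNoise_sub he (s := 0) (t := t) zero_le θ
  rw [expNoise_add b e θ 0 t]
  simp only [Pi.mul_apply, expNoise, dirNoise_zero]
  simp only [dirNoise_zero, NNReal.coe_zero, sub_zero] at h
  simp only [NNReal.coe_zero, mul_zero, zero_div, sub_zero, Real.exp_zero, one_mul,
    integral_mul_const, h]
  rw [← Real.exp_add, add_neg_cancel, Real.exp_zero]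

lemma condExp_expNoise (hQ : IsDiffusionLaw b x Q) (hb : Continuous b) (he : ‖e‖ = 1)
    (θ : ℝ) {s t : ℝ≥0} (hst : s ≤ t) :
    Q[expNoise b e θ t | pathSigma s] =ᵐ[Q] expNoise b e θ s := by
  have := hQ.isProbabilityMeasure
  have hint := hQ.integrable_expNoise hb he θ t
  set g : PathSpace d → ℝ := fun π => Real.exp (θ * (dirNoise b e t π - dirNoise b e s π)) *
        Real.exp (- (θ ^ 2 * ((t : ℝ) - s) / 2)) with hg
  have hgint : Integrable g Q := (hQ.integrable_exp_dirNoise_sub hb he hst θ).mul_const _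
  rw [expNoise_add b e θ s t] at hint ⊢
  have hmeas : Measurable (fun π => noise b t π - noise b s π) :=
    ((measurable_noise hb t).mono (pathSigma_le t) le_rfl).sub
      ((measurable_noise hb s).mono (pathSigma_le s) le_rfl)
  have hgm : StronglyMeasurable[MeasurableSpace.comap
      (fun π => noise b t π - noise b s π) inferInstance] g := by
    refine Measurable.stronglyMeasurable ?_
    simp only [hg, dirNoise_sub]
    have : Measurable fun y : E d => Real.exp (θ * inner ℝ e y) *
        Real.exp (- (θ ^ 2 * ((t : ℝ) - s) / 2)) := by fun_prop
    exact this.comp (comap_measurable _)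
  have h1 := condExp_mul_of_stronglyMeasurable_left (m := pathSigma s)
    (measurable_expNoise hb e θ s).stronglyMeasurable hint hgint
  have h2 := condExp_indep_eq hmeas.comap_le (pathSigma_le s) hgm (hQ.increment_indep s t hst)
  have h3 : Q[g] = 1 := by
    simp only [hg]
    rw [integral_mul_const, hQ.integral_exp_dirNoise_sub he hst, ← Real.exp_add, add_neg_cancel,
      Real.exp_zero]
  filter_upwards [h1, h2] with π hπ1 hπ2
  rw [hπ1, Pi.mul_apply, hπ2, h3, mul_one]

lemma martingale_expNoise (hQ : IsDiffusionLaw b x Q) (hb : Continuous b) (he : ‖e‖ = 1)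
    (θ : ℝ) (t : ℕ → ℝ≥0) (ht : Monotone t) :
    Martingale (fun n => expNoise b e θ (t n)) (sampledFiltration t ht) Q :=
  ⟨fun n => (measurable_expNoise hb e θ (t n)).stronglyMeasurable,
    fun _ _ hij => hQ.condExp_expNoise hb he θ (ht hij)⟩

/-- Doob's maximal inequality at level `exp a`, for a nonnegative martingale of mean one. -/
lemma measure_exists_le_sampled (hQ : IsDiffusionLaw b x Q) (hb : Continuous b) (he : ‖e‖ = 1)
    (θ a : ℝ) (t : ℕ → ℝ≥0) (ht : Monotone t) (n : ℕ) :
    Q {π | ∃ k ≤ n, a ≤ θ * dirNoise b e (t k) π - θ ^ 2 * t k / 2}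
      ≤ ENNReal.ofReal (Real.exp (-a)) := by
  have := hQ.isProbabilityMeasure
  have h := maximal_ineq (hQ.martingale_expNoise hb he θ t ht).submartingale
    (fun k π => (Real.exp_pos _).le) (ε := (Real.exp a).toNNReal) n
  have hset : {π : PathSpace d | ∃ k ≤ n, a ≤ θ * dirNoise b e (t k) π - θ ^ 2 * t k / 2}
      = {π | ((Real.exp a).toNNReal : ℝ) ≤ (Finset.range (n + 1)).sup'
        Finset.nonempty_range_add_one fun k => expNoise b e θ (t k) π} := by
    ext π
    simp [Finset.le_sup'_iff, expNoise, Real.coe_toNNReal _ (Real.exp_pos a).le]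
  rw [← hset] at h
  have h1 : ∫ π in {π | ∃ k ≤ n, a ≤ θ * dirNoise b e (t k) π - θ ^ 2 * t k / 2},
      expNoise b e θ (t n) π ∂Q ≤ 1 := by
    rw [← hQ.integral_expNoise he θ (t n)]
    exact setIntegral_le_integral (hQ.integrable_expNoise hb he θ (t n))
      (Filter.Eventually.of_forall fun π => (Real.exp_pos _).le)
  have h2 := h.trans (ENNReal.ofReal_le_one.2 h1)
  rw [Real.exp_neg, ENNReal.ofReal_inv_of_pos (Real.exp_pos a), ← one_div]
  rw [ENNReal.le_div_iff_mul_le (Or.inl (by simp [Real.exp_pos])) (Or.inl ENNReal.ofReal_ne_top),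
    mul_comm]
  exact h2

/-- The exponential maximal inequality: the noise in a given direction exceeds a line
with probability exponentially small in the offset. -/
lemma measure_exists_lt (hQ : IsDiffusionLaw b x Q) (hb : Continuous b) (he : ‖e‖ = 1)
    (θ a : ℝ) :
    Q {π | ∃ t : ℝ≥0, a < θ * dirNoise b e t π - θ ^ 2 * t / 2}
      ≤ ENNReal.ofReal (Real.exp (-a)) := by
  -- Stage `n` uses the dyadic times of mesh `2⁻ⁿ` up to `2ⁿ`: mesh and horizon improve together,
  -- and the grids are nested.
  set A : ℕ → Set (PathSpace d) := fun n => {π | ∃ k : ℕ, k ≤ 4 ^ n ∧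
    a ≤ θ * dirNoise b e ((k : ℝ≥0) / 2 ^ n) π - θ ^ 2 * ((k : ℝ≥0) / 2 ^ n : ℝ≥0) / 2} with hA
  have hmono : Monotone A := by
    refine monotone_nat_of_le_succ fun n π => ?_
    rintro ⟨k, hk, h⟩
    refine ⟨2 * k, by rw [pow_succ]; omega, ?_⟩
    have : ((2 * k : ℕ) : ℝ≥0) / 2 ^ (n + 1) = (k : ℝ≥0) / 2 ^ n := by
      rw [pow_succ]; push_cast; field_simp
    rwa [this]
  -- The strict inequality is an open condition in `t`, hence survives at nearby dyadic times.
  have hsub : {π | ∃ t : ℝ≥0, a < θ * dirNoise b e t π - θ ^ 2 * t / 2} ⊆ ⋃ n, A n := by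
    rintro π ⟨t, ht⟩
    have hp : Filter.Tendsto (fun n : ℕ => (2 : ℝ≥0) ^ n) Filter.atTop Filter.atTop :=
      tendsto_pow_atTop_atTop_of_one_lt one_lt_two
    have hp' : Filter.Tendsto (fun n : ℕ => (2 : ℝ) ^ n) Filter.atTop Filter.atTop :=
      tendsto_pow_atTop_atTop_of_one_lt one_lt_two
    have hlim : Filter.Tendsto (fun n : ℕ => (⌊(t : ℝ) * 2 ^ n⌋₊ : ℝ≥0) / 2 ^ n) Filter.atTop
        (nhds t) := by
      rw [← NNReal.tendsto_coe]
      push_cast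
      exact (tendsto_nat_floor_mul_div_atTop t.2).comp hp'
    have hcont : Continuous fun t : ℝ≥0 => θ * dirNoise b e t π - θ ^ 2 * t / 2 := by
      have := continuous_dirNoise hb e π
      fun_prop
    have hev := hlim.eventually (hcont.continuousAt.eventually (lt_mem_nhds ht))
    obtain ⟨n, hn1, hn2⟩ := (hev.and (hp.eventually_ge_atTop t)).exists
    refine mem_iUnion.2 ⟨n, ⌊(t : ℝ) * 2 ^ n⌋₊, ?_, hn1.le⟩
    refine Nat.floor_le_of_le ?_
    calc (t : ℝ) * 2 ^ n ≤ 2 ^ n * 2 ^ n := by gcongr; exact_mod_cast hn2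
      _ = ((4 ^ n : ℕ) : ℝ) := by rw [← mul_pow]; norm_num
  refine (measure_mono hsub).trans ?_
  rw [hmono.measure_iUnion]
  refine iSup_le fun n => hQ.measure_exists_le_sampled hb he θ a (fun k => (k : ℝ≥0) / 2 ^ n)
    (fun i j hij => ?_) (4 ^ n)
  dsimp only
  gcongr

end IsDiffusionLaw

end Diffusion

end PassiveTracer

end

namespace PassiveTracer

/-! ### Comparison of the displacement with drifted noise -/

section Diffusion

variable {d : ℕ}

lemma dirNoise_add_integral {b : E d → E d} (hb : Continuous b) (e : E d) (t : ℝ≥0)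
    (π : PathSpace d) :
    dirNoise b e t π + ∫ s in (0 : ℝ)..t, inner ℝ e (b (π s.toNNReal)) = inner ℝ e (π t - π 0) := by
  have hc : Continuous fun s : ℝ => b (π s.toNNReal) := by fun_prop
  have h := (innerSL ℝ e).intervalIntegral_comp_comm (hc.intervalIntegrable (μ := volume) 0 (t : ℝ))
  simp only [innerSL_apply_apply] at h
  rw [h, dirNoise, ← inner_add_right]
  congr 1
  simp only [noise, NNReal.coe_zero, intervalIntegral.integral_same]
  abel

lemma le_inner_displacement {b : E d → E d} (hb : Continuous b) {e : E d} {c : ℝ}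
    (hc : ∀ y, c ≤ inner ℝ e (b y)) (t : ℝ≥0) (π : PathSpace d) :
    c * t + dirNoise b e t π ≤ inner ℝ e (π t - π 0) := by
  have hcont : Continuous fun s : ℝ => (inner ℝ e (b (π s.toNNReal)) : ℝ) := by fun_prop
  have h := intervalIntegral.integral_mono_on (μ := volume) (a := 0) (b := (t : ℝ)) t.2
    (continuous_const (y := c) |>.intervalIntegrable _ _) (hcont.intervalIntegrable _ _)
    fun s _ => hc _
  rw [intervalIntegral.integral_const, sub_zero, smul_eq_mul] at h
  rw [← dirNoise_add_integral hb e t π]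
  linarith

lemma inner_displacement_le {b : E d → E d} (hb : Continuous b) {e : E d} {K : ℝ}
    (hK : ∀ y, inner ℝ e (b y) ≤ K) (t : ℝ≥0) (π : PathSpace d) :
    inner ℝ e (π t - π 0) ≤ K * t + dirNoise b e t π := by
  have hcont : Continuous fun s : ℝ => (inner ℝ e (b (π s.toNNReal)) : ℝ) := by fun_prop
  have h := intervalIntegral.integral_mono_on (μ := volume) (a := 0) (b := (t : ℝ)) t.2
    (hcont.intervalIntegrable _ _) (continuous_const (y := K) |>.intervalIntegrable _ _)
    fun s _ => hK _
  rw [intervalIntegral.integral_const, sub_zero, smul_eq_mul] at h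
  rw [← dirNoise_add_integral hb e t π]
  linarith

/-! ### Hitting times and measurability -/

lemma exists_mem_of_hitTime_lt_top {S : Set (E d)} {π : PathSpace d} (h : hitTime S π < ∞) :
    ∃ t, π t ∈ S := by
  by_contra! hn
  simp [hitTime, hn] at h

lemma exists_hitTime_eq {S : Set (E d)} (hS : IsClosed S) {π : PathSpace d}
    (h : hitTime S π < ∞) :
    ∃ t₀ : ℝ≥0, hitTime S π = t₀ ∧ π t₀ ∈ S ∧ ∀ t, π t ∈ S → t₀ ≤ t := by
  have hne : {t | π t ∈ S}.Nonempty := exists_mem_of_hitTime_lt_top h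
  have hcl : IsClosed {t | π t ∈ S} := hS.preimage π.continuous
  have hmin : ∀ t, π t ∈ S → sInf {t | π t ∈ S} ≤ t := fun t ht => csInf_le (OrderBot.bddBelow _) ht
  have hmem : π (sInf {t | π t ∈ S}) ∈ S := hcl.csInf_mem hne (OrderBot.bddBelow _)
  refine ⟨sInf {t | π t ∈ S}, le_antisymm (iInf₂_le (sInf {t | π t ∈ S}) hmem) ?_, hmem, hmin⟩
  exact le_iInf₂ fun t ht => ENNReal.coe_le_coe.2 (hmin t ht)

/-- The description of a finite backtrack time, and of the maximal excursion before it. -/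
lemma exists_backtrackTime_eq {e : E d} {π : PathSpace d} (h : backtrackTime e π < ∞) :
    ∃ t₀ : ℝ≥0, (inner ℝ e (π t₀ - π 0) : ℝ) ≤ -1 ∧
      (∀ t : ℝ≥0, (inner ℝ e (π t - π 0) : ℝ) ≤ -1 → t₀ ≤ t) ∧
      maxExcursion e π = sSup ((fun t : ℝ≥0 => (inner ℝ e (π t - π 0) : ℝ)) '' Iic t₀) := by
  have hcl : IsClosed {y : E d | (inner ℝ e y : ℝ) ≤ -1 + inner ℝ e (π 0)} :=
    isClosed_le (by fun_prop) (by fun_prop)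
  obtain ⟨t₀, h1, h2, h3⟩ := exists_hitTime_eq hcl h
  have hiff : ∀ t : ℝ≥0, (inner ℝ e (π t - π 0) : ℝ) ≤ -1 ↔
      (inner ℝ e (π t) : ℝ) ≤ -1 + inner ℝ e (π 0) := fun t => by
    rw [inner_sub_right, sub_le_iff_le_add]
  refine ⟨t₀, (hiff t₀).2 h2, fun t ht => h3 t ((hiff t).1 ht), ?_⟩
  have h1' : backtrackTime e π = t₀ := h1
  rw [maxExcursion, h1']
  congr 2
  ext t
  simp

lemma backtrackTime_lt_top_iff {e : E d} {π : PathSpace d} :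
    backtrackTime e π < ∞ ↔ ∃ n : ℕ, ∃ t : ℝ≥0, t ≤ n ∧ (inner ℝ e (π t - π 0) : ℝ) ≤ -1 := by
  constructor
  · intro h
    obtain ⟨t₀, h1, -⟩ := exists_backtrackTime_eq h
    obtain ⟨n, hn⟩ := exists_nat_ge t₀
    exact ⟨n, t₀, hn, h1⟩
  · rintro ⟨-, t, -, ht⟩
    refine lt_of_le_of_lt (iInf₂_le t ?_) (ENNReal.coe_lt_top (r := t))
    rw [inner_sub_right, sub_le_iff_le_add] at ht
    exact ht

lemma measurable_inner_displacement (e : E d) (t : ℝ≥0) :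
    Measurable fun π : PathSpace d => (inner ℝ e (π t - π 0) : ℝ) :=
  (continuous_const.inner continuous_id).measurable.comp
    ((measurable_eval_path t).sub (measurable_eval_path 0))

lemma continuous_inner_displacement (e : E d) (π : PathSpace d) :
    Continuous fun t : ℝ≥0 => (inner ℝ e (π t - π 0) : ℝ) := by fun_prop

/-- Reaching a closed half-line before a given time is a measurable event for a continuous
real-valued process. -/
lemma measurableSet_exists_le_of_continuous {α : Type*} [MeasurableSpace α] {X : ℝ≥0 → α → ℝ}
    (hX : ∀ t, Measurable (X t)) (hc : ∀ ω, Continuous fun t => X t ω) (q : ℝ≥0) (a : ℝ) :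
    MeasurableSet {ω | ∃ t ≤ q, X t ω ≤ a} := by
  obtain ⟨s, hs, hd⟩ := TopologicalSpace.exists_countable_dense ℝ≥0
  -- The minimum over the compact `[0, q]` is attained, so coming within every `1 / (n + 1)` of `a`
  -- at dense times suffices; `min r q` keeps the times in range.
  have heq : {ω | ∃ t ≤ q, X t ω ≤ a} =
      ⋂ n : ℕ, ⋃ r ∈ s, {ω | X (min r q) ω < a + 1 / ((n : ℝ) + 1)} := by
    ext ω
    simp only [mem_ofPred_eq, mem_iInter, mem_iUnion, exists_prop]
    constructor
    · rintro ⟨t, htq, ht⟩ n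
      have ho : IsOpen {r : ℝ≥0 | X (min r q) ω < a + 1 / ((n : ℝ) + 1)} :=
        isOpen_lt ((hc ω).comp (by fun_prop)) continuous_const
      obtain ⟨r, hr, hrs⟩ := hd.inter_open_nonempty _ ho
        ⟨t, by
          have : (0 : ℝ) < 1 / ((n : ℝ) + 1) := Nat.one_div_pos_of_nat
          simp only [mem_ofPred_eq, min_eq_left htq]
          linarith⟩
      exact ⟨r, hrs, hr⟩
    · intro h
      obtain ⟨t, ht, hmin⟩ := (isCompact_Icc (a := (0 : ℝ≥0)) (b := q)).exists_isMinOn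
        ⟨0, by simp⟩ (hc ω).continuousOn
      refine ⟨t, ht.2, le_of_forall_pos_lt_add fun ε hε => ?_⟩
      obtain ⟨n, hn⟩ := exists_nat_one_div_lt hε
      obtain ⟨r, -, hr⟩ := h n
      have := hmin (show min r q ∈ Icc 0 q from ⟨zero_le, min_le_right _ _⟩)
      simp only [mem_ofPred_eq] at this
      linarith
  rw [heq]
  exact .iInter fun n => .biUnion hs fun r _ => measurableSet_lt (hX _) measurable_const

lemma measurableSet_backtrackTime_lt_top (e : E d) :
    MeasurableSet {π : PathSpace d | backtrackTime e π < ∞} := by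
  have : {π : PathSpace d | backtrackTime e π < ∞} =
      ⋃ n : ℕ, {π | ∃ t ≤ (n : ℝ≥0), (inner ℝ e (π t - π 0) : ℝ) ≤ -1} := by
    ext π
    simp [backtrackTime_lt_top_iff]
  rw [this]
  exact .iUnion fun n => measurableSet_exists_le_of_continuous (measurable_inner_displacement e)
    (continuous_inner_displacement e) _ _

lemma bddAbove_image_Iic {f : ℝ≥0 → ℝ} (hf : Continuous f) (t₀ : ℝ≥0) :
    BddAbove (f '' Iic t₀) := by
  have : Iic t₀ = Icc 0 t₀ := by ext; simp
  rw [this]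
  exact (isCompact_Icc.image hf).bddAbove

lemma maxExcursion_nonneg {e : E d} {π : PathSpace d} (h : backtrackTime e π < ∞) :
    0 ≤ maxExcursion e π := by
  obtain ⟨t₀, -, -, hM⟩ := exists_backtrackTime_eq h
  rw [hM]
  exact le_csSup (bddAbove_image_Iic (continuous_inner_displacement e π) t₀) ⟨0, by simp, by simp⟩

lemma aemeasurable_maxExcursion (e : E d) (Q : Measure (PathSpace d)) :
    AEMeasurable (maxExcursion e) (Q.restrict {π | backtrackTime e π < ∞}) := by
  classical
  obtain ⟨s, hs, hd⟩ := TopologicalSpace.exists_countable_dense ℝ≥0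
  have := hs.to_subtype
  set X : ℝ≥0 → PathSpace d → ℝ := fun t π => inner ℝ e (π t - π 0) 
  have hXm : ∀ t, Measurable (X t) := measurable_inner_displacement e
  have hXc : ∀ π, Continuous fun t => X t π := continuous_inner_displacement e
  -- The displacement is replaced by `0` from the backtrack time on; this does not affect the
  -- supremum, as the excursion starts from `0`.
  set H : s → PathSpace d → ℝ := fun r π => if ∃ t ≤ (r : ℝ≥0), X t π ≤ -1 then 0 else X r π with hH
  have hHm : ∀ r, Measurable (H r) := fun r =>
    Measurable.ite (measurableSet_exists_le_of_continuous hXm hXc r (-1)) measurable_const (hXm r)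
  refine ⟨fun π => ⨆ r, H r π, Measurable.iSup hHm, ?_⟩
  refine ae_restrict_of_forall_mem (measurableSet_backtrackTime_lt_top e) fun π hπ => ?_
  obtain ⟨t₀, ht₀, hmin, hM⟩ := exists_backtrackTime_eq hπ
  have hbdd := bddAbove_image_Iic (hXc π) t₀
  have hne : Nonempty s := hd.nonempty.to_subtype
  have hle : ∀ r, H r π ≤ maxExcursion e π := by
    intro r
    rw [hM]
    by_cases hr : ∃ t ≤ (r : ℝ≥0), X t π ≤ -1
    · simp only [hH, hr, if_true]
      exact le_csSup hbdd ⟨0, by simp, by simp⟩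
    · simp only [hH, hr, if_false]
      refine le_csSup hbdd ⟨r, ?_, rfl⟩
      by_contra hlt
      exact hr ⟨t₀, (not_le.1 hlt).le, ht₀⟩
  have hHb : BddAbove (range fun r => H r π) := ⟨_, by rintro _ ⟨r, rfl⟩; exact hle r⟩
  refine le_antisymm ?_ (ciSup_le hle)
  -- Needed to exclude `t = t₀` below, where the displacement is at most `-1`.
  have hpos : 0 ≤ ⨆ r, H r π := by
    obtain ⟨r, hr, hrs⟩ := hd.inter_open_nonempty _ (isOpen_Ioi (a := t₀)) ⟨t₀ + 1, by simp⟩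
    refine le_ciSup_of_le hHb ⟨r, hrs⟩ ?_
    have : ∃ t ≤ r, X t π ≤ -1 := ⟨t₀, le_of_lt hr, ht₀⟩
    simp only [hH, this, if_true, le_refl]
  rw [hM]
  refine csSup_le ⟨_, 0, by simp, rfl⟩ ?_
  rintro _ ⟨t, ht, rfl⟩
  by_contra! hlt
  have hlt' : ⨆ r, H r π < X t π := hlt
  have htt : t < t₀ := by
    refine lt_of_le_of_ne ht ?_
    rintro rfl
    have : X t π ≤ -1 := ht₀
    linarith
  obtain ⟨r, ⟨hr1, hr2⟩, hrs⟩ := hd.inter_open_nonempty _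
    ((isOpen_Iio (a := t₀)).inter (isOpen_lt continuous_const (hXc π))) ⟨t, htt, hlt'⟩
  have hno : ¬ ∃ t ≤ r, X t π ≤ -1 := by
    rintro ⟨t', h1, h2⟩
    exact absurd (hmin t' h2) (not_le.2 (lt_of_le_of_lt h1 hr1))
  have := le_ciSup hHb ⟨r, hrs⟩
  simp only [hH, hno, if_false] at this
  exact absurd this (not_le.2 hr2)

/-- A real function with an exponential tail has a bounded integral. -/
lemma integrable_and_integral_le_of_exp_tail {α : Type*} [MeasurableSpace α] {μ : Measure α}
    {f : α → ℝ} (hf : AEMeasurable f μ) (h0 : 0 ≤ᵐ[μ] f) {C κ : ℝ} (hC : 0 ≤ C) (hκ : 0 < κ)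
    (htail : ∀ y, 0 < y → μ {ω | y < f ω} ≤ ENNReal.ofReal (C * Real.exp (-κ * y))) :
    Integrable f μ ∧ ∫ ω, f ω ∂μ ≤ C / κ := by
  have hint : ∫ y in Ioi (0 : ℝ), C * Real.exp (-κ * y) = C / κ := by
    rw [integral_const_mul, integral_exp_mul_Ioi (by linarith)]
    simp
    ring
  have hI : IntegrableOn (fun y => C * Real.exp (-κ * y)) (Ioi (0 : ℝ)) :=
    (integrableOn_exp_mul_Ioi (by linarith) 0).const_mul C
  have hle : ∫⁻ ω, ENNReal.ofReal (f ω) ∂μ ≤ ENNReal.ofReal (C / κ) := by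
    -- Layer-cake formula.
    rw [lintegral_eq_lintegral_meas_lt μ h0 hf, ← hint, ofReal_integral_eq_lintegral_ofReal hI
      (Filter.Eventually.of_forall fun y => by positivity)]
    exact setLIntegral_mono' measurableSet_Ioi fun y hy => htail y hy
  refine ⟨⟨hf.aestronglyMeasurable, ?_⟩, ?_⟩
  · rw [hasFiniteIntegral_iff_ofReal h0]
    exact lt_of_le_of_lt hle ENNReal.ofReal_lt_top
  · rw [integral_eq_lintegral_of_nonneg_ae h0 hf.aestronglyMeasurable]
    exact ENNReal.toReal_le_of_le_ofReal (by positivity) hle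

/-! ### The three estimates for a drift between `c` and `K` -/

namespace IsDiffusionLaw

variable {b : E d → E d} {x e : E d} {Q : Measure (PathSpace d)}

/-- With drift at least `c` in the direction `e`, a backtrack by `M` is exponentially unlikely. -/
lemma measure_exists_displacement_le (hQ : IsDiffusionLaw b x Q) (hb : Continuous b)
    (he : ‖e‖ = 1) {c : ℝ} (hc0 : 0 < c) (hc : ∀ y, c ≤ inner ℝ e (b y)) {M : ℝ} (hM : 0 < M) :
    Q {π | ∃ t : ℝ≥0, (inner ℝ e (π t - π 0) : ℝ) ≤ -M} ≤ ENNReal.ofReal (Real.exp (-c * M)) := by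
  rw [neg_mul]
  -- From `B_t ≤ -M - c t`, the choice `θ = -2c` cancels the terms in `t` and leaves at least `2 c
  -- M`; settling for `c M` makes the inequality strict.
  refine (measure_mono ?_).trans (hQ.measure_exists_lt hb he (-2 * c) (c * M))
  rintro π ⟨t, ht⟩
  refine ⟨t, ?_⟩
  have h := le_inner_displacement hb hc t π
  nlinarith [mul_pos hc0 hM]

lemma ofReal_le_measure_backtrackTime_eq_top (hQ : IsDiffusionLaw b x Q) (hb : Continuous b)
    (he : ‖e‖ = 1) {c : ℝ} (hc0 : 0 < c) (hc : ∀ y, c ≤ inner ℝ e (b y)) :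
    ENNReal.ofReal (1 - Real.exp (-c)) ≤ Q {π | backtrackTime e π = ∞} := by
  have := hQ.isProbabilityMeasure
  have h1 : Q {π | backtrackTime e π < ∞} ≤ ENNReal.ofReal (Real.exp (-c)) := by
    refine (measure_mono ?_).trans
      ((hQ.measure_exists_displacement_le hb he hc0 hc one_pos).trans_eq (by rw [mul_one]))
    intro π hπ
    obtain ⟨t₀, ht₀, -⟩ := exists_backtrackTime_eq hπ
    exact ⟨t₀, ht₀⟩
  have h2 : {π : PathSpace d | backtrackTime e π = ∞} = {π | backtrackTime e π < ∞}ᶜ := by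
    ext π
    simp
  rw [h2, prob_compl_eq_one_sub (measurableSet_backtrackTime_lt_top e),
    ENNReal.ofReal_sub _ (Real.exp_pos _).le, ENNReal.ofReal_one]
  exact tsub_le_tsub_left h1 1

lemma measure_timeBelow_lt_timeAbove_le (hQ : IsDiffusionLaw b x Q) (hb : Continuous b)
    (he : ‖e‖ = 1) {c : ℝ} (hc0 : 0 < c) (hc : ∀ y, c ≤ inner ℝ e (b y)) {M : ℝ} (hM : 0 < M) :
    Q {π | timeBelow e (inner ℝ x e - M) π < timeAbove e (inner ℝ x e + M) π} ≤
      ENNReal.ofReal (Real.exp (-c * M)) := by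
  refine (measure_mono_ae ?_).trans (hQ.measure_exists_displacement_le hb he hc0 hc hM)
  filter_upwards [hQ.start] with π h0 hπ
  -- The upper level serves only to make the lower hitting time finite.
  obtain ⟨t, ht⟩ := exists_mem_of_hitTime_lt_top (lt_of_lt_of_le hπ le_top)
  refine ⟨t, ?_⟩
  have ht' : (inner ℝ e (π t) : ℝ) ≤ inner ℝ x e - M := ht
  rw [inner_sub_right, h0, real_inner_comm x e]
  linarith

/-- If `B_t > y / 2 + K t` at the time `t` when the displacement exceeds `y`, then `θ = 2K` gives an
exponent above `K y`. Otherwise `y < 2 K t + y / 2`, so the backtrack time `t₀` exceeds `y / (4K)`;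
as `B_{t₀} ≤ -1 - c t₀`, the choice `θ = -c` gives more than `c² t₀ / 2 > c² y / (8K)`. -/
lemma measure_lt_maxExcursion_le (hQ : IsDiffusionLaw b x Q) (hb : Continuous b)
    (he : ‖e‖ = 1) {c K : ℝ} (hc0 : 0 < c) (hK0 : 0 < K) (hc : ∀ y, c ≤ inner ℝ e (b y))
    (hK : ∀ y, inner ℝ e (b y) ≤ K) {y : ℝ} (hy : 0 < y) :
    Q ({π | y < maxExcursion e π} ∩ {π | backtrackTime e π < ∞}) ≤
      ENNReal.ofReal (2 * Real.exp (-(min K (c ^ 2 / (8 * K))) * y)) := by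
  set κ := min K (c ^ 2 / (8 * K)) with hκ
  have hκ1 : κ * y ≤ K * y := by gcongr; exact min_le_left _ _
  have hκ2 : κ * y ≤ c ^ 2 / (8 * K) * y := by gcongr; exact min_le_right _ _
  have hsub : {π | y < maxExcursion e π} ∩ {π | backtrackTime e π < ∞} ⊆
      {π | ∃ t : ℝ≥0, κ * y < (2 * K) * dirNoise b e t π - (2 * K) ^ 2 * t / 2} ∪
      {π | ∃ t : ℝ≥0, κ * y < (-c) * dirNoise b e t π - (-c) ^ 2 * t / 2} := by
    rintro π ⟨h1, h2⟩
    obtain ⟨t₀, ht₀, -, hM⟩ := exists_backtrackTime_eq h2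
    rw [mem_ofPred_eq, hM] at h1
    obtain ⟨_, ⟨t, ht, rfl⟩, hyt⟩ :=
      exists_lt_of_lt_csSup (nonempty_Iic.image _) h1
    have hup := inner_displacement_le hb hK t π
    have hlow := le_inner_displacement hb hc t₀ π
    have htt : (t : ℝ) ≤ t₀ := ht
    dsimp only at hyt
    rcases lt_or_ge (y / 2) (dirNoise b e t π - K * t) with h | h
    · left
      refine ⟨t, ?_⟩
      nlinarith
    · right
      refine ⟨t₀, ?_⟩
      have h3 : y / (4 * K) < t₀ := by
        rw [div_lt_iff₀ (by positivity)]
        nlinarith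
      have h4 : c ^ 2 / (8 * K) * y = c ^ 2 / 2 * (y / (4 * K)) := by
        field_simp
        ring
      have h5 : c ^ 2 / 2 * (y / (4 * K)) < c ^ 2 / 2 * t₀ := by gcongr
      nlinarith
  refine (measure_mono hsub).trans ((measure_union_le _ _).trans ?_)
  refine (add_le_add (hQ.measure_exists_lt hb he (2 * K) (κ * y))
    (hQ.measure_exists_lt hb he (-c) (κ * y))).trans_eq ?_
  rw [← ENNReal.ofReal_add (Real.exp_pos _).le (Real.exp_pos _).le, neg_mul, two_mul]

lemma integrableOn_maxExcursion_and_integral_le (hQ : IsDiffusionLaw b x Q) (hb : Continuous b)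
    (he : ‖e‖ = 1) {c K : ℝ} (hc0 : 0 < c) (hK0 : 0 < K) (hc : ∀ y, c ≤ inner ℝ e (b y))
    (hK : ∀ y, inner ℝ e (b y) ≤ K) :
    IntegrableOn (maxExcursion e) {π | backtrackTime e π < ∞} Q ∧
      ∫ π in {π | backtrackTime e π < ∞}, maxExcursion e π ∂Q ≤ 2 / min K (c ^ 2 / (8 * K)) := by
  have hS := measurableSet_backtrackTime_lt_top e
  refine integrable_and_integral_le_of_exp_tail (aemeasurable_maxExcursion e Q)
    (ae_restrict_of_forall_mem hS fun π hπ => maxExcursion_nonneg hπ) zero_le_two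
    (lt_min hK0 (by positivity)) fun y hy => ?_
  rw [Measure.restrict_apply' hS]
  exact hQ.measure_lt_maxExcursion_le hb he hc0 hK0 hc hK hy

end IsDiffusionLaw

end Diffusion

end PassiveTracer


theorem lemma3p1 {d : ℕ} {Ω : Type*} [TopologicalSpace Ω] [PolishSpace Ω] [MeasurableSpace Ω]
    [BorelSpace Ω] [AddAction (E d) Ω] (P : Measure Ω) [IsProbabilityMeasure P]
    (hT : SpatiallyHomogeneous d P) (u : Ω → E d) (hu : NullMeasurable u P)
    (hA : CondA u P) (hDR : CondDR u P) (hR : CondR u P) :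
    ∃ γ γ₁ γ₂ : ℝ, 0 < γ ∧ 0 < γ₁ ∧ 0 < γ₂ ∧
      ∀ x : E d, ∀ᵐ ω ∂P, ∀ Q : Measure (PathSpace d), IsDiffusionLaw (field u ω) x Q →
        ENNReal.ofReal γ ≤ Q {π | backtrackTime (driftDir u P) π = ∞} ∧
        (∀ M : ℝ, 0 < M →
          Q {π | timeBelow (driftDir u P) (inner ℝ x (driftDir u P) - M) π <
              timeAbove (driftDir u P) (inner ℝ x (driftDir u P) + M) π} ≤
            ENNReal.ofReal (Real.exp (-γ₁ * M))) ∧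
        IntegrableOn (maxExcursion (driftDir u P))
          {π | backtrackTime (driftDir u P) π < ∞} Q ∧
        ∫ π in {π | backtrackTime (driftDir u P) π < ∞}, maxExcursion (driftDir u P) π ∂Q ≤ γ₂ := by
  obtain ⟨R, hR0, hRv, hRae⟩ := hA.exists_ae_norm_sub_le
  set v := meanDrift u P with hv
  set e := driftDir u P
  have hvpos : 0 < ‖v‖ := hR0.trans_lt hRv
  have he1 : ‖e‖ = 1 := norm_driftDir (norm_pos_iff.1 hvpos)
  have hc0 : 0 < ‖v‖ - R := sub_pos.2 hRv
  have hK0 : 0 < ‖v‖ + R := by positivity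
  refine ⟨1 - Real.exp (-(‖v‖ - R)), ‖v‖ - R,
    2 / min (‖v‖ + R) ((‖v‖ - R) ^ 2 / (8 * (‖v‖ + R))), ?_, hc0, ?_, fun x => ?_⟩
  · rw [sub_pos, Real.exp_lt_one_iff]
    linarith
  · have : 0 < min (‖v‖ + R) ((‖v‖ - R) ^ 2 / (8 * (‖v‖ + R))) := lt_min hK0 (by positivity)
    positivity
  -- The exceptional null set depends neither on `x` nor on `Q`.
  filter_upwards [hT.ae_forall_norm_field_sub_le (fun ω => (hR.contDiff ω).continuous) hRae]
    with ω hω Q hQ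
  have hb : Continuous (field u ω) := (hR.contDiff ω).continuous
  have habs : ∀ y, |inner ℝ e (field u ω y) - ‖v‖| ≤ R := fun y => by
    rw [hv, ← inner_driftDir_meanDrift, ← inner_sub_right]
    refine (abs_real_inner_le_norm _ _).trans ?_
    rw [he1, one_mul]
    exact hω y
  have hc : ∀ y, ‖v‖ - R ≤ inner ℝ e (field u ω y) := fun y => by
    linarith [(abs_le.1 (habs y)).1]
  have hK : ∀ y, inner ℝ e (field u ω y) ≤ ‖v‖ + R := fun y => by
    linarith [(abs_le.1 (habs y)).2]
  exact ⟨hQ.ofReal_le_measure_backtrackTime_eq_top hb he1 hc0 hc,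
    fun M hM => hQ.measure_timeBelow_lt_timeAbove_le hb he1 hc0 hc hM,
    hQ.integrableOn_maxExcursion_and_integral_le hb he1 hc0 hK0 hc hK⟩
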